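/- Let $G=(V,E)$ be a simple graph with a countable (finite or infinite) vertex set, and let $(p_e)_{e\in E}$ be arbitrary numbers in $[0,1]$. Consider Bernoulli bond percolation on $G$: every edge $e\in E$ is open with probability $p_e$ and closed otherwise, independently of all other edges. Two vertices are in the same cluster if they are joined by a path of open edges. For vertices $a,b,c\in V$, write $\mathbf P(abc)$ for the probability that $a,b,c$ are all in the same cluster, $\mathbf P(a\|b\|c)$ for the probability that $a,b,c$ are in three different clusters, $\mathbf P(ab\|c)$ for the probability that $a$ and $b$ are in the same cluster and $c$ is in a different one, and similarly $\mathbf P(ac\|b)$ and $\mathbf P(a\|bc)$. Then for all $a,b,c\in V$ $$\mathbf P(abc)\,\mathbf P(a\|b\|c)\;\ge\;\mathbf P(ab\|c)\,\mathbf P(ac\|b)+\mathbf P(ab\|c)\,\mathbf P(a\|bc)+\mathbf P(ac\|b)\,\mathbf P(a\|bc).$$ -/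

import Mathlib

open MeasureTheory ProbabilityTheory

namespace BondPercolation

/-- The law of Bernoulli bond percolation on `G`: the edges are independently open (`true`) or
closed (`false`), and the edge `e` is open with its own probability `p e`. -/
noncomputable def law {V : Type*} (G : SimpleGraph V) (p : G.edgeSet → unitInterval) :
    Measure (G.edgeSet → Bool) :=
  Measure.infinitePi fun e => bernoulliMeasure true false (p e)

/-- The spanning subgraph of `G` whose edges are the open edges of the configuration `ω`. -/
def openSubgraph {V : Type*} (G : SimpleGraph V) (ω : G.edgeSet → Bool) : SimpleGraph V where
  Adj u v := ∃ h : G.Adj u v, ω ⟨s(u, v), h⟩ = true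
  symm := ⟨fun u v ⟨h, hω⟩ => ⟨h.symm, by
    rw [← hω]; exact congrArg ω (Subtype.ext Sym2.eq_swap)⟩⟩
  loopless := ⟨fun _ ⟨h, _⟩ => G.irrefl h⟩

/-- `u` and `v` are in the same cluster of `ω`: some path of open edges joins them. -/
def SameCluster {V : Type*} (G : SimpleGraph V) (ω : G.edgeSet → Bool) (u v : V) : Prop :=
  (openSubgraph G ω).Reachable u v

/-- The event `v₁₁…v₁ₖ‖v₂₁…v₂ₗ‖…`, for the list `[[v₁₁, …, v₁ₖ], [v₂₁, …, v₂ₗ], …]` of blocks: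
vertices of one block are in the same cluster, and vertices of blocks at different positions are in
different clusters. -/
def blockEvent {V : Type*} (G : SimpleGraph V) (blocks : List (List V)) :
    Set (G.edgeSet → Bool) :=
  {ω | (∀ B ∈ blocks, ∀ u ∈ B, ∀ v ∈ B, SameCluster G ω u v) ∧
    blocks.Pairwise fun B B' => ∀ u ∈ B, ∀ v ∈ B', ¬ SameCluster G ω u v}

/-- The probability of `v₁₁…v₁ₖ‖v₂₁…v₂ₗ‖…` in bond percolation on `G` with edge
probabilities `p`. -/
noncomputable def prob {V : Type*} (G : SimpleGraph V) (p : G.edgeSet → unitInterval)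
    (blocks : List (List V)) : ℝ :=
  (law G p).real (blockEvent G blocks)

end BondPercolation

/-! Let `x`, `y`, `z` be the probabilities of the connections `ab`, `ac`, `bc`. By transitivity any
two of these events imply the third, so all their intersections are one event, of probability `g`,
and the claim is that `defect x y z g` is nonnegative. Expanding, `defect` equals `g - Q`, where `Q
= g² - g(x+y+z) + xy+xz+yz` is a quadratic form. Conditioning on an edge that is open with
probability `t` therefore gives the mixture of the two conditional defects plus `t(1-t)` times `Q`
of the increments (`defect_mix_nonneg`). The three events and their pairwise unions are increasing,
and this suffices for `Q ≥ 0` (`pairing_nonneg`). Induction on the edges settles finite edge sets,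
starting from deterministic configurations; countable graphs follow by exhaustion. -/

namespace BondPercolation

/-! ### Finitely many edges: induction by conditioning on one edge -/

section Finite

variable {E : Type*} [DecidableEq E]

/-- The expectation of `f` at the random subset of `F` that contains each `e ∈ F` independently
with probability `p e`. -/
def expect (p : E → ℝ) (F : Finset E) (f : Finset E → ℝ) : ℝ :=
  ∑ T ∈ F.powerset, (∏ e ∈ F, if e ∈ T then p e else 1 - p e) * f T

lemma expect_empty (p : E → ℝ) (f : Finset E → ℝ) : expect p ∅ f = f ∅ := by
  simp [expect]

lemma expect_insert (p : E → ℝ) {F : Finset E} {e : E} (he : e ∉ F) (f : Finset E → ℝ) :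
    expect p (insert e F) f =
      p e * expect p F (fun T => f (insert e T)) + (1 - p e) * expect p F f := by
  unfold expect
  rw [Finset.sum_powerset_insert he, add_comm, Finset.mul_sum, Finset.mul_sum]
  congr 1 <;> refine Finset.sum_congr rfl fun T hT => ?_
  · rw [Finset.prod_insert he, if_pos (Finset.mem_insert_self e T), mul_assoc]
    congr 2
    refine Finset.prod_congr rfl fun e' he' => ?_
    have : e' ≠ e := fun h => he (h ▸ he')
    simp [this]
  · rw [Finset.prod_insert he, if_neg fun h => he (Finset.mem_powerset.1 hT h), mul_assoc]

lemma expect_add (p : E → ℝ) (F : Finset E) (f g : Finset E → ℝ) :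
    expect p F (f + g) = expect p F f + expect p F g := by
  simp [expect, mul_add, Finset.sum_add_distrib]

lemma expect_sub (p : E → ℝ) (F : Finset E) (f g : Finset E → ℝ) :
    expect p F (f - g) = expect p F f - expect p F g := by
  simp [expect, mul_sub, Finset.sum_sub_distrib]

lemma expect_mono {p : E → ℝ} (hp : ∀ e, p e ∈ Set.Icc (0 : ℝ) 1) (F : Finset E)
    {f g : Finset E → ℝ} (hfg : f ≤ g) : expect p F f ≤ expect p F g := by
  refine Finset.sum_le_sum fun T _ => mul_le_mul_of_nonneg_left (hfg T) ?_
  refine Finset.prod_nonneg fun e _ => ?_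
  split_ifs
  · exact (hp e).1
  · linarith [(hp e).2]

lemma expect_le_expect_insert {p : E → ℝ} (hp : ∀ e, p e ∈ Set.Icc (0 : ℝ) 1) (F : Finset E)
    {f : Finset E → ℝ} (hf : Monotone f) (e : E) :
    expect p F f ≤ expect p F (fun T => f (insert e T)) :=
  expect_mono hp F fun T => hf (Finset.subset_insert e T)

/-- For three events of probabilities `x`, `y`, `z` whose pairwise intersections all equal one event
of probability `g`, this is the probability that all occur times the probability that none
occurs, minus the sum over pairs of the products of the probabilities that exactly the one
and exactly the other occurs. -/
def defect (x y z g : ℝ) : ℝ :=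
  g * (1 - x - y - z + 2 * g) - ((x - g) * (y - g) + (x - g) * (z - g) + (y - g) * (z - g))

/-- The form equals `(g - x)(g - y) + z(x + y - g)`, and likewise under permutations of `x`, `y`,
`z`. Two of the three numbers lie on the same side of `g`; factoring with those two makes both terms
nonnegative. -/
lemma pairing_nonneg {x y z g : ℝ} (hx : 0 ≤ x) (hy : 0 ≤ y) (hz : 0 ≤ z) (hxy : g ≤ x + y)
    (hxz : g ≤ x + z) (hyz : g ≤ y + z) :
    0 ≤ g ^ 2 - g * (x + y + z) + (x * y + x * z + y * z) := by
  rcases le_total x g with h1 | h1 <;> rcases le_total y g with h2 | h2 <;>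
    rcases le_total z g with h3 | h3 <;>
    nlinarith [mul_nonneg (sub_nonneg.2 h1) (sub_nonneg.2 h2), mul_nonneg hz (sub_nonneg.2 hxy)]

/-- Primed values belong to the open edge. In the application `x + y - g` is the probability of a
union, so the last three hypotheses say that opening the edge makes unions likelier. -/
lemma defect_mix_nonneg {t x y z g x' y' z' g' : ℝ} (ht : t ∈ Set.Icc (0 : ℝ) 1)
    (h : 0 ≤ defect x y z g) (h' : 0 ≤ defect x' y' z' g') (hx : x ≤ x') (hy : y ≤ y')
    (hz : z ≤ z') (hxy : x + y - g ≤ x' + y' - g') (hxz : x + z - g ≤ x' + z' - g')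
    (hyz : y + z - g ≤ y' + z' - g') :
    0 ≤ defect (t * x' + (1 - t) * x) (t * y' + (1 - t) * y) (t * z' + (1 - t) * z)
      (t * g' + (1 - t) * g) := by
  have key := pairing_nonneg (x := x' - x) (y := y' - y) (z := z' - z) (g := g' - g)
    (by linarith) (by linarith) (by linarith) (by linarith) (by linarith) (by linarith)
  have h1 : 0 ≤ 1 - t := sub_nonneg.2 ht.2
  have := add_nonneg (add_nonneg (mul_nonneg ht.1 h') (mul_nonneg h1 h))
    (mul_nonneg (mul_nonneg ht.1 h1) key)
  refine this.trans_eq ?_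
  unfold defect
  ring

lemma Monotone.comp_insert {f : Finset E → ℝ} (hf : Monotone f) (e : E) :
    Monotone fun T => f (insert e T) :=
  fun _ _ h => hf (Finset.insert_subset_insert e h)

theorem defect_expect_nonneg {p : E → ℝ} (hp : ∀ e, p e ∈ Set.Icc (0 : ℝ) 1) (F : Finset E)
    {f₁ f₂ f₃ g : Finset E → ℝ} (h₁ : Monotone f₁) (h₂ : Monotone f₂) (h₃ : Monotone f₃)
    (h₁₂ : Monotone (f₁ + f₂ - g)) (h₁₃ : Monotone (f₁ + f₃ - g)) (h₂₃ : Monotone (f₂ + f₃ - g))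
    (hd : ∀ T, 0 ≤ defect (f₁ T) (f₂ T) (f₃ T) (g T)) :
    0 ≤ defect (expect p F f₁) (expect p F f₂) (expect p F f₃) (expect p F g) := by
  induction F using Finset.induction_on generalizing f₁ f₂ f₃ g with
  | empty => simpa only [expect_empty] using hd ∅
  | insert e F he ih =>
    have union_le : ∀ {u v : Finset E → ℝ}, Monotone (u + v - g) →
        expect p F u + expect p F v - expect p F g ≤ expect p F (fun T => u (insert e T)) +
          expect p F (fun T => v (insert e T)) - expect p F (fun T => g (insert e T)) := by
      intro u v h
      have := expect_le_expect_insert hp F h e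
      rw [expect_sub, expect_add] at this
      refine this.trans_eq ?_
      rw [← expect_add, ← expect_sub]
      rfl
    simp only [expect_insert p he]
    exact defect_mix_nonneg (hp e) (ih h₁ h₂ h₃ h₁₂ h₁₃ h₂₃ hd)
      (ih (Monotone.comp_insert h₁ e) (Monotone.comp_insert h₂ e) (Monotone.comp_insert h₃ e)
        (Monotone.comp_insert h₁₂ e) (Monotone.comp_insert h₁₃ e) (Monotone.comp_insert h₂₃ e)
        fun T => hd _)
      (expect_le_expect_insert hp F h₁ e) (expect_le_expect_insert hp F h₂ e)
      (expect_le_expect_insert hp F h₃ e) (union_le h₁₂) (union_le h₁₃) (union_le h₂₃)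

open Classical in
/-- A strong form of Harris's inequality for three increasing events with equal pairwise
intersections. -/
theorem defect_expect_ite_nonneg {p : E → ℝ} (hp : ∀ e, p e ∈ Set.Icc (0 : ℝ) 1) (F : Finset E)
    {A₁ A₂ A₃ B : Finset E → Prop} (h₁ : Monotone A₁) (h₂ : Monotone A₂) (h₃ : Monotone A₃)
    (h₁₂ : ∀ T, A₁ T ∧ A₂ T ↔ B T) (h₁₃ : ∀ T, A₁ T ∧ A₃ T ↔ B T)
    (h₂₃ : ∀ T, A₂ T ∧ A₃ T ↔ B T) :
    0 ≤ defect (expect p F fun T => if A₁ T then 1 else 0)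
      (expect p F fun T => if A₂ T then 1 else 0) (expect p F fun T => if A₃ T then 1 else 0)
      (expect p F fun T => if B T then 1 else 0) := by
  have mono : ∀ {A : Finset E → Prop}, Monotone A →
      Monotone fun T => if A T then (1 : ℝ) else 0 := by
    intro A h S T hST
    have : A S → A T := h hST
    by_cases A S <;> by_cases A T <;> simp_all
  -- As `B` is the intersection of `A` and `A'`, this function is the indicator of their union.
  have mono_union : ∀ {A A' : Finset E → Prop}, Monotone A → Monotone A' →
      (∀ T, A T ∧ A' T ↔ B T) → Monotone ((fun T => if A T then (1 : ℝ) else 0) +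
        (fun T => if A' T then (1 : ℝ) else 0) - fun T => if B T then (1 : ℝ) else 0) := by
    intro A A' h h' hB S T hST
    have h1 : A S → A T := h hST
    have h2 : A' S → A' T := h' hST
    simp only [Pi.sub_apply, Pi.add_apply, ← hB]
    by_cases A S <;> by_cases A' S <;> by_cases A T <;> by_cases A' T <;> simp_all
  refine defect_expect_nonneg hp F (mono h₁) (mono h₂) (mono h₃) (mono_union h₁ h₂ h₁₂)
    (mono_union h₁ h₃ h₁₃) (mono_union h₂ h₃ h₂₃) fun T => ?_
  have k₁₂ := h₁₂ T
  have k₁₃ := h₁₃ T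
  have k₂₃ := h₂₃ T
  unfold defect
  -- In a fixed configuration none, exactly one or all of the three events occur, and the defect
  -- vanishes in each case.
  by_cases A₁ T <;> by_cases A₂ T <;> by_cases A₃ T <;> by_cases B T <;> simp_all
  norm_num

end Finite

/-! ### Countably many edges: exhaustion by finite windows -/

section Window

variable {E : Type*}

/-- The open edges of `ω` that lie in `F`. -/
def openEdges (F : Finset E) (ω : E → Bool) : Finset E :=
  F.filter fun e => ω e = true

lemma setOf_openEdges_eq [DecidableEq E] {F T : Finset E} (hT : T ⊆ F) :
    {ω : E → Bool | openEdges F ω = T} = Set.pi F fun e => {decide (e ∈ T)} := by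
  ext ω
  simp only [openEdges, Set.mem_ofPred_eq, Finset.ext_iff, Finset.mem_filter, Set.mem_pi,
    Finset.mem_coe, Set.mem_singleton_iff]
  refine ⟨fun h e he => ?_, fun h e => ⟨fun ⟨he, hω⟩ => ?_, fun he => ⟨hT he, ?_⟩⟩⟩
  · rw [Bool.eq_iff_iff, decide_eq_true_iff, ← h e]
    simp [he]
  · simpa [hω] using h e he
  · simpa [he] using h e (hT he)

lemma measurableSet_openEdges_eq (F T : Finset E) :
    MeasurableSet {ω : E → Bool | openEdges F ω = T} := by
  classical
  by_cases hT : T ⊆ F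
  · rw [setOf_openEdges_eq hT]
    exact .pi F.countable_toSet fun _ _ => measurableSet_singleton _
  · convert MeasurableSet.empty
    exact Set.eq_empty_of_forall_notMem fun ω h => hT (h ▸ Finset.filter_subset _ _)

lemma setOf_openEdges_eq_biUnion (F : Finset E) (P : Finset E → Prop) [DecidablePred P] :
    {ω : E → Bool | P (openEdges F ω)} =
      ⋃ T ∈ F.powerset.filter P, {ω : E → Bool | openEdges F ω = T} := by
  ext ω
  simp [openEdges, Finset.filter_subset]

lemma measurableSet_openEdges (F : Finset E) (P : Finset E → Prop) :
    MeasurableSet {ω : E → Bool | P (openEdges F ω)} := by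
  classical
  rw [setOf_openEdges_eq_biUnion]
  exact Finset.measurableSet_biUnion _ fun T _ => measurableSet_openEdges_eq F T

lemma real_openEdges_eq [DecidableEq E] (p : E → unitInterval) {F T : Finset E} (hT : T ⊆ F) :
    (Measure.infinitePi fun e => bernoulliMeasure true false (p e)).real
      {ω | openEdges F ω = T} = ∏ e ∈ F, if e ∈ T then (p e : ℝ) else 1 - p e := by
  rw [setOf_openEdges_eq hT, measureReal_def,
    Measure.infinitePi_pi _ fun _ _ => measurableSet_singleton _, ENNReal.toReal_prod]
  refine Finset.prod_congr rfl fun e _ => ?_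
  rw [← measureReal_def]
  by_cases he : e ∈ T <;> simp [he]

lemma real_openEdges [DecidableEq E] (p : E → unitInterval) (F : Finset E) (P : Finset E → Prop)
    [DecidablePred P] :
    (Measure.infinitePi fun e => bernoulliMeasure true false (p e)).real
      {ω | P (openEdges F ω)} = expect (fun e => p e) F fun T => if P T then 1 else 0 := by
  rw [setOf_openEdges_eq_biUnion, measureReal_biUnion_finset
    (fun T _ T' _ h => Set.disjoint_left.2 fun ω hω hω' => h (hω.symm.trans hω'))
    fun T _ => measurableSet_openEdges_eq F T]
  simp only [expect, mul_ite, mul_one, mul_zero, ← Finset.sum_filter]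
  refine Finset.sum_congr rfl fun T hT => real_openEdges_eq p ?_
  exact Finset.mem_powerset.1 (Finset.mem_filter.1 hT).1

lemma openEdges_mono {F F' : Finset E} (h : F ⊆ F') (ω : E → Bool) :
    openEdges F ω ⊆ openEdges F' ω :=
  Finset.filter_subset_filter _ h

open Filter Topology in
lemma tendsto_real_openEdges [Countable E] (μ : Measure (E → Bool)) [IsFiniteMeasure μ]
    {P : Finset E → Prop} (hP : Monotone P) :
    Tendsto (fun F => μ.real {ω | P (openEdges F ω)}) atTop
      (𝓝 (μ.real {ω | ∃ F, P (openEdges F ω)})) := by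
  have hm : Monotone fun F : Finset E => {ω : E → Bool | P (openEdges F ω)} :=
    fun F F' h ω hω => hP (openEdges_mono h ω) hω
  have := tendsto_measure_iUnion_atTop (μ := μ) hm
  rw [← Set.ofPred_exists] at this
  exact (ENNReal.tendsto_toReal (measure_ne_top _ _)).comp this

lemma measurableSet_exists_openEdges [Countable E] (P : Finset E → Prop) :
    MeasurableSet {ω : E → Bool | ∃ F, P (openEdges F ω)} := by
  rw [Set.ofPred_exists]
  exact .iUnion fun F => measurableSet_openEdges F P

/-- `defect_expect_ite_nonneg` for countably many independent coordinates and events that are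
determined by finite sets of open coordinates. -/
theorem defect_real_nonneg [Countable E] (p : E → unitInterval) {A₁ A₂ A₃ B : Finset E → Prop}
    (h₁ : Monotone A₁) (h₂ : Monotone A₂) (h₃ : Monotone A₃) (h₁₂ : ∀ T, A₁ T ∧ A₂ T ↔ B T)
    (h₁₃ : ∀ T, A₁ T ∧ A₃ T ↔ B T) (h₂₃ : ∀ T, A₂ T ∧ A₃ T ↔ B T) {μ : Measure (E → Bool)}
    (hμ : μ = Measure.infinitePi fun e => bernoulliMeasure true false (p e)) :
    0 ≤ defect (μ.real {ω | ∃ F, A₁ (openEdges F ω)}) (μ.real {ω | ∃ F, A₂ (openEdges F ω)})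
      (μ.real {ω | ∃ F, A₃ (openEdges F ω)}) (μ.real {ω | ∃ F, B (openEdges F ω)}) := by
  classical
  have : IsProbabilityMeasure μ := hμ ▸ inferInstance
  have hB : Monotone B := by
    intro S T hST hS
    rw [← h₁₂] at hS ⊢
    exact ⟨h₁ hST hS.1, h₂ hST hS.2⟩
  have t₁ := tendsto_real_openEdges μ h₁
  have t₂ := tendsto_real_openEdges μ h₂
  have t₃ := tendsto_real_openEdges μ h₃
  have t := tendsto_real_openEdges μ hB
  -- The defect is a polynomial, so it passes to the limit along the windows `F`.
  refine ge_of_tendsto' ((t.mul ((((t₁.const_sub 1).sub t₂).sub t₃).add (t.const_mul 2))).sub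
    ((((t₁.sub t).mul (t₂.sub t)).add ((t₁.sub t).mul (t₃.sub t))).add
      ((t₂.sub t).mul (t₃.sub t)))) fun F => ?_
  simp only [hμ, real_openEdges]
  exact defect_expect_ite_nonneg (fun e => (p e).2) F h₁ h₂ h₃ h₁₂ h₁₃ h₂₃

end Window

/-! ### Clusters and partitions of three vertices -/

section Percolation

variable {V : Type*} (G : SimpleGraph V)

instance (p : G.edgeSet → unitInterval) : IsProbabilityMeasure (law G p) := by
  unfold law
  infer_instance

open Classical in
/-- `u` and `v` are joined by a path of edges in `T`. -/
def ConnectedIn (u v : V) (T : Finset G.edgeSet) : Prop :=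
  SameCluster G (fun e => decide (e ∈ T)) u v

variable {G}

lemma SameCluster.mono {ω ω' : G.edgeSet → Bool} {u v : V} (h : ∀ e, ω e = true → ω' e = true)
    (huv : SameCluster G ω u v) : SameCluster G ω' u v :=
  SimpleGraph.Reachable.mono
    (show openSubgraph G ω ≤ openSubgraph G ω' from fun _ _ ⟨hG, hω⟩ => ⟨hG, h _ hω⟩) huv

lemma connectedIn_mono (u v : V) : Monotone (ConnectedIn G u v) := by
  intro S T h hS
  refine SameCluster.mono (fun e he => ?_) hS
  simp only [decide_eq_true_eq] at he ⊢
  exact h he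

/-- A path has finitely many edges, so a connection is already visible in some finite window. -/
lemma sameCluster_iff_exists {ω : G.edgeSet → Bool} {u v : V} :
    SameCluster G ω u v ↔ ∃ F, ConnectedIn G u v (openEdges F ω) := by
  classical
  refine ⟨fun ⟨w⟩ => ?_, fun ⟨F, h⟩ =>
    SameCluster.mono (fun e he => ?_) h⟩
  swap
  · simp only [decide_eq_true_eq, openEdges, Finset.mem_filter] at he
    exact he.2
  induction w with
  | nil => exact ⟨∅, SimpleGraph.Reachable.refl _⟩
  | @cons u v _ hadj w ih =>
    obtain ⟨hG, hω⟩ := hadj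
    obtain ⟨F, hF⟩ := ih ⟨w⟩
    refine ⟨insert ⟨s(u, v), hG⟩ F, SimpleGraph.Reachable.trans (SimpleGraph.Adj.reachable ⟨hG, ?_⟩)
      (connectedIn_mono _ _ (openEdges_mono (Finset.subset_insert _ F) ω) hF)⟩
    simpa [openEdges] using hω

/-- The inequality for partitions of three vertices, in terms of the connection probabilities. -/
lemma defect_connection_nonneg [Countable V] (p : G.edgeSet → unitInterval) (a b c : V) :
    0 ≤ defect ((law G p).real {ω | SameCluster G ω a b}) ((law G p).real {ω | SameCluster G ω a c})
      ((law G p).real {ω | SameCluster G ω b c})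
      ((law G p).real {ω | SameCluster G ω a b ∧ SameCluster G ω a c}) := by
  have h := defect_real_nonneg p (connectedIn_mono a b) (connectedIn_mono a c)
    (connectedIn_mono b c) (B := fun T => ConnectedIn G a b T ∧ ConnectedIn G a c T)
    (fun T => Iff.rfl)
    (fun T => and_congr_right fun h => ⟨fun h' => h.trans h', fun h' => h.symm.trans h'⟩)
    (fun T => ⟨fun h => ⟨h.1.trans h.2.symm, h.1⟩, fun h => ⟨h.2, h.1.symm.trans h.2⟩⟩)
    (μ := law G p) rfl
  convert h using 3
  · simp only [sameCluster_iff_exists]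
  · simp only [sameCluster_iff_exists]
  · simp only [sameCluster_iff_exists]
  · ext ω
    simp only [Set.mem_ofPred_eq, sameCluster_iff_exists]
    refine ⟨fun ⟨⟨F, hF⟩, ⟨F', hF'⟩⟩ => ?_, fun ⟨F, h⟩ => ⟨⟨F, h.1⟩, ⟨F, h.2⟩⟩⟩
    classical
    -- The two connections may need different windows; their union serves both.
    exact ⟨F ∪ F', connectedIn_mono _ _ (openEdges_mono Finset.subset_union_left ω) hF,
      connectedIn_mono _ _ (openEdges_mono Finset.subset_union_right ω) hF'⟩

lemma measurableSet_sameCluster [Countable V] (u v : V) :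
    MeasurableSet {ω | SameCluster G ω u v} := by
  simp only [sameCluster_iff_exists]
  exact measurableSet_exists_openEdges _

lemma SameCluster.symm {ω : G.edgeSet → Bool} {u v : V} (h : SameCluster G ω u v) :
    SameCluster G ω v u :=
  SimpleGraph.Reachable.symm h

lemma SameCluster.trans {ω : G.edgeSet → Bool} {u v w : V} (h : SameCluster G ω u v)
    (h' : SameCluster G ω v w) : SameCluster G ω u w :=
  SimpleGraph.Reachable.trans h h'

lemma SameCluster.refl (ω : G.edgeSet → Bool) (u : V) : SameCluster G ω u u :=
  SimpleGraph.Reachable.refl u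

lemma sameCluster_comm {ω : G.edgeSet → Bool} {u v : V} :
    SameCluster G ω u v ↔ SameCluster G ω v u :=
  ⟨.symm, .symm⟩

lemma prob_triple (p : G.edgeSet → unitInterval) (a b c : V) :
    prob G p [[a, b, c]] = (law G p).real {ω | SameCluster G ω a b ∧ SameCluster G ω a c} := by
  unfold prob
  congr 1
  ext ω
  have h : SameCluster G ω a b → SameCluster G ω a c → SameCluster G ω b c :=
    fun h h' => h.symm.trans h'
  simp only [blockEvent, List.mem_cons, List.not_mem_nil, or_false, forall_eq, forall_eq_or_imp,
    List.pairwise_cons, List.Pairwise.nil, Set.mem_ofPred_eq, SameCluster.refl,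
    sameCluster_comm (u := b) (v := a), sameCluster_comm (u := c) (v := a),
    sameCluster_comm (u := c) (v := b)]
  tauto

lemma prob_pair_left [Countable V] (p : G.edgeSet → unitInterval) (a b c : V) :
    prob G p [[a, b], [c]] = (law G p).real {ω | SameCluster G ω a b} -
      (law G p).real {ω | SameCluster G ω a b ∧ SameCluster G ω a c} := by
  refine Eq.trans ?_ (measureReal_sdiff (fun ω h => h.1)
    ((measurableSet_sameCluster a b).inter (measurableSet_sameCluster a c)))
  unfold prob
  congr 1
  ext ω
  have h : SameCluster G ω a b → SameCluster G ω b c → SameCluster G ω a c := .trans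
  simp only [blockEvent, List.mem_cons, List.not_mem_nil, or_false, forall_eq, forall_eq_or_imp,
    List.pairwise_cons, List.Pairwise.nil, Set.mem_ofPred_eq, SameCluster.refl, Set.mem_sdiff,
    sameCluster_comm (u := b) (v := a)]
  tauto

lemma prob_pair_right [Countable V] (p : G.edgeSet → unitInterval) (a b c : V) :
    prob G p [[a], [b, c]] = (law G p).real {ω | SameCluster G ω b c} -
      (law G p).real {ω | SameCluster G ω a b ∧ SameCluster G ω a c} := by
  refine Eq.trans ?_ (measureReal_sdiff (fun ω h => h.1.symm.trans h.2)
    ((measurableSet_sameCluster a b).inter (measurableSet_sameCluster a c)))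
  unfold prob
  congr 1
  ext ω
  have h : SameCluster G ω a b → SameCluster G ω b c → SameCluster G ω a c := .trans
  have h' : SameCluster G ω a c → SameCluster G ω b c → SameCluster G ω a b :=
    fun h h' => h.trans h'.symm
  simp only [blockEvent, List.mem_cons, List.not_mem_nil, or_false, forall_eq, forall_eq_or_imp,
    List.pairwise_cons, List.Pairwise.nil, Set.mem_ofPred_eq, SameCluster.refl, Set.mem_sdiff,
    sameCluster_comm (u := c) (v := b)]
  tauto

/-- Inclusion–exclusion: the three pairwise intersections and the triple one coincide, whence the
coefficient `3 - 1 = 2`. -/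
lemma prob_singletons [Countable V] (p : G.edgeSet → unitInterval) (a b c : V) :
    prob G p [[a], [b], [c]] = 1 - (law G p).real {ω | SameCluster G ω a b} -
      (law G p).real {ω | SameCluster G ω a c} - (law G p).real {ω | SameCluster G ω b c} +
      2 * (law G p).real {ω | SameCluster G ω a b ∧ SameCluster G ω a c} := by
  have hS : blockEvent G [[a], [b], [c]] = (({ω | SameCluster G ω a b} ∪
      {ω | SameCluster G ω a c}) ∪ {ω | SameCluster G ω b c})ᶜ := by
    ext ω
    simp only [blockEvent, List.mem_cons, List.not_mem_nil, or_false, forall_eq, forall_eq_or_imp,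
      List.pairwise_cons, List.Pairwise.nil, Set.mem_ofPred_eq, SameCluster.refl, Set.mem_compl_iff,
      Set.mem_union]
    tauto
  have mab := measurableSet_sameCluster (G := G) a b
  have mac := measurableSet_sameCluster (G := G) a c
  have mbc := measurableSet_sameCluster (G := G) b c
  have h₁ := measureReal_union_add_inter (μ := law G p) (s := {ω | SameCluster G ω a b}) mac
  have h₂ := measureReal_union_add_inter (μ := law G p)
    (s := {ω | SameCluster G ω a b} ∪ {ω | SameCluster G ω a c}) mbc
  have hI : ({ω | SameCluster G ω a b} ∪ {ω | SameCluster G ω a c}) ∩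
      {ω | SameCluster G ω b c} = {ω | SameCluster G ω a b} ∩ {ω | SameCluster G ω a c} := by
    ext ω
    have k₁ : SameCluster G ω a b → SameCluster G ω b c → SameCluster G ω a c := .trans
    have k₂ : SameCluster G ω a c → SameCluster G ω b c → SameCluster G ω a b :=
      fun h h' => h.trans h'.symm
    have k₃ : SameCluster G ω a b → SameCluster G ω a c → SameCluster G ω b c :=
      fun h h' => h.symm.trans h'
    simp only [Set.mem_inter_iff, Set.mem_union, Set.mem_ofPred_eq]
    tauto
  rw [hI] at h₂
  rw [prob, hS, measureReal_compl ((mab.union mac).union mbc), probReal_univ, Set.ofPred_and]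
  linarith

end Percolation

end BondPercolation

theorem mainTheorem6 {V : Type*} [Countable V] (G : SimpleGraph V)
    (p : G.edgeSet → unitInterval) (a b c : V) :
    BondPercolation.prob G p [[a, b, c]] * BondPercolation.prob G p [[a], [b], [c]] ≥
      BondPercolation.prob G p [[a, b], [c]] * BondPercolation.prob G p [[a, c], [b]] +
      BondPercolation.prob G p [[a, b], [c]] * BondPercolation.prob G p [[a], [b, c]] +
      BondPercolation.prob G p [[a, c], [b]] * BondPercolation.prob G p [[a], [b, c]] := by
  have key := BondPercolation.defect_connection_nonneg p a b c
  rw [BondPercolation.prob_triple, BondPercolation.prob_singletons, BondPercolation.prob_pair_left,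
    BondPercolation.prob_pair_left p a c b, BondPercolation.prob_pair_right]
  -- Exchanging `b` and `c` in `prob_pair_left` has reversed the conjunction defining the common
  -- intersection.
  simp only [and_comm (a := BondPercolation.SameCluster G _ a c)]
  exact sub_nonneg.1 key
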